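/- **Theorem 2 (Lower bound).** Let $\beta>1$, $c_1,c_2>0$, $s>0$, $0\le\gamma\le\min(s,1)$ and $R,\sigma,L>0$. There is a constant $C>0$, depending only on these numbers, such that the following holds. Let $\mathcal X\subset\mathbb R^d$ be compact, let $\mathcal H$ be a reproducing kernel Hilbert space of real functions on $\mathcal X$ with continuous kernel $k$, and let $\mu$ be a probability measure on $\mathcal X$. Let $S_k:\mathcal H\to L^2(\mathcal X,\mu)$ be the inclusion and $L_k=S_kS_k^*$. Assume that $L_k$ has infinitely many positive eigenvalues $\lambda_1\ge\lambda_2\ge\dots>0$ (counted with multiplicity), with orthonormal eigenfunctions $e_1,e_2,\dots\in L^2(\mathcal X,\mu)$, so that $L_k=\sum_i\lambda_i\langle\cdot,e_i\rangle_{L^2}e_i$, and that $c_1i^{-\beta}\le\lambda_i\le c_2i^{-\beta}$ for all $i\ge1$. For $t\ge0$ let $$[\mathcal H]^t=\Big\{\sum_i a_i\lambda_i^{t/2}e_i:\ (a_i)\in\ell^2\Big\},\qquad \Big\|\sum_i a_i\lambda_i^{t/2}e_i\Big\|_{[\mathcal H]^t}=\|(a_i)\|_{\ell^2},$$ and $\|f\|_{[\mathcal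 H]^t}=\infty$ for $f\in L^2(\mathcal X,\mu)\setminus[\mathcal H]^t$. Let $\mathcal P$ be the set of all probability distributions $\rho$ of $(x,y)$ on $\mathcal X\times\mathbb R$ with marginal $\mu$ on $\mathcal X$ and $\int y^2\,d\rho<\infty$ such that the conditional mean $f^*_\rho(x)=\mathbb E_\rho[y\mid x]$ satisfies $f_\rho^*\in[\mathcal H]^s$, $\|f^*_\rho\|_{[\mathcal H]^s}\le R$, and such that for every integer $m\ge2$ $$\mathbb E_\rho\big(|y-f^*_\rho(x)|^m\mid x\big)\le\tfrac12\,m!\,\sigma^2L^{m-2}\qquad\text{for }\mu\text{-a.e. }x\in\mathcal X.$$ Then for every $\delta\in(0,1)$ there is $n_0$ such that for every $n\ge n_0$ and every estimator, i.e. every measurable map $\hat f:(\mathcal X\times\mathbb R)^n\to L^2(\mathcal X,\mu)$, there is $\rho\in\mathcal P$ such that, for an i.i.d. sample $Z$ of size $n$ from $\rho$, with probability at least $1-\delta$, $$\big\|\hat f(Z)-f^*_\rho\big\|^2_{[\mathcal H]^\gamma}\ \ge\ C\,\delta\,n^{-\frac{(s-\gamma)\beta}{s\beta+1}} .$$ 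-/

import Mathlib

open MeasureTheory ProbabilityTheory
open scoped ENNReal RealInnerProductSpace

namespace SpectralLower

noncomputable section

section Embedding

variable {X : Type*} [TopologicalSpace X]
variable (H : Type*) [NormedAddCommGroup H] [InnerProductSpace ℝ H] [CompleteSpace H]
  [RKHS ℝ H X ℝ]

/-- The scalar reproducing kernel `k(x, x')` of a real RKHS. -/
def scalarKernel (x x' : X) : ℝ := RKHS.kernel H x x' 1

/-- The kernel function is jointly continuous. -/
def ContinuousKernel : Prop := Continuous fun p : X × X => scalarKernel H p.1 p.2

variable {H}

theorem continuous_of_inner_self {E : Type*} [NormedAddCommGroup E] [InnerProductSpace ℝ E]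
    (v : X → E) (h : Continuous fun p : X × X => ⟪v p.1, v p.2⟫) : Continuous v := by
  rw [continuous_iff_continuousAt]
  intro x₀
  have h1 : Continuous fun x : X => ⟪v x, v x⟫ := h.comp (continuous_id.prodMk continuous_id)
  have h2 : Continuous fun x : X => ⟪v x, v x₀⟫ := h.comp (continuous_id.prodMk continuous_const)
  have hc : Continuous fun x : X => √(⟪v x, v x⟫ - 2 * ⟪v x, v x₀⟫ + ⟪v x₀, v x₀⟫) :=
    ((h1.sub (continuous_const.mul h2)).add continuous_const).sqrt
  have hsq : ∀ x : X, ‖v x - v x₀‖ = √(⟪v x, v x⟫ - 2 * ⟪v x, v x₀⟫ + ⟪v x₀, v x₀⟫) := by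
    intro x
    rw [real_inner_self_eq_norm_sq, real_inner_self_eq_norm_sq, ← norm_sub_sq_real,
      Real.sqrt_sq (norm_nonneg _)]
  rw [ContinuousAt, tendsto_iff_norm_sub_tendsto_zero]
  simp_rw [hsq]
  have h0 := hc.tendsto x₀
  rwa [show ⟪v x₀, v x₀⟫ - 2 * ⟪v x₀, v x₀⟫ + ⟪v x₀, v x₀⟫ = (0 : ℝ) by ring,
    Real.sqrt_zero] at h0

theorem continuous_kerFun (hk : ContinuousKernel H (X := X)) :
    Continuous fun x : X => RKHS.kerFun H x (1 : ℝ) := by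
  refine continuous_of_inner_self (fun x : X => RKHS.kerFun H x (1 : ℝ)) ?_
  have key : (fun p : X × X => ⟪RKHS.kerFun H p.1 (1 : ℝ), RKHS.kerFun H p.2 (1 : ℝ)⟫) =
      fun p : X × X => scalarKernel H p.1 p.2 := by
    funext p
    rw [RKHS.kerFun_inner, RKHS.kerFun_apply]
    simp [scalarKernel]
  rw [key]
  exact hk

theorem continuous_of_mem (hk : ContinuousKernel H (X := X)) (f : H) :
    Continuous fun x : X => f x := by
  have h : (fun x : X => f x) = fun x => ⟪RKHS.kerFun H x (1 : ℝ), f⟫ := by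
    funext x
    simp
  rw [h]
  exact (continuous_kerFun hk).inner continuous_const

variable [CompactSpace X]

/-- The inclusion of the RKHS into the continuous functions, as a linear map. -/
def toContinuousMapₗ (hk : ContinuousKernel H (X := X)) : H →ₗ[ℝ] C(X, ℝ) where
  toFun f := ⟨fun x => f x, continuous_of_mem hk f⟩
  map_add' f g := by ext x; simp
  map_smul' c f := by ext x; simp

/-- The inclusion of the RKHS into the continuous functions, as a bounded linear map. -/
def toContinuousMapL (hk : ContinuousKernel H (X := X)) : H →L[ℝ] C(X, ℝ) where
  toLinearMap := toContinuousMapₗ hk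
  cont := by
    refine (toContinuousMapₗ hk).continuous_of_seq_closed_graph fun u f g hu hg => ?_
    ext x
    have h1 : Filter.Tendsto (fun n => (toContinuousMapₗ hk (u n)) x) Filter.atTop (nhds (g x)) :=
      ((continuous_eval_const x).tendsto g).comp hg
    have h2 : Filter.Tendsto (fun n => (u n) x) Filter.atTop (nhds (f x)) :=
      ((RKHS.continuous_eval x).tendsto f).comp hu
    exact tendsto_nhds_unique h1 h2

variable [MeasurableSpace X] [BorelSpace X] (μ : Measure X) [IsFiniteMeasure μ]

/-- The natural inclusion `S_k : H → L²(X, μ)`. -/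
def inclusionL2 (hk : ContinuousKernel H (X := X)) : H →L[ℝ] Lp ℝ 2 μ :=
  (ContinuousMap.toLp 2 μ ℝ).comp (toContinuousMapL hk)

/-- The integral operator `L_k = S_k S_k^* : L²(X, μ) → L²(X, μ)`. -/
def integralOperator (hk : ContinuousKernel H (X := X)) : Lp ℝ 2 μ →L[ℝ] Lp ℝ 2 μ :=
  (inclusionL2 μ hk).comp (inclusionL2 μ hk).adjoint

/-- `(lam, e)` lists the positive eigenvalues of `L_k` in non-increasing order (with multiplicity)
and a corresponding orthonormal family of eigenfunctions, there being infinitely many of them;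
`lam i`, `e i` is the `(i+1)`-st eigenpair. -/
structure IsEigensystem (hk : ContinuousKernel H (X := X)) (lam : ℕ → ℝ) (e : ℕ → Lp ℝ 2 μ) :
    Prop where
  pos : ∀ i, 0 < lam i
  antitone : Antitone lam
  orthonormal : Orthonormal ℝ e
  spectral : ∀ f : Lp ℝ 2 μ,
    HasSum (fun i => (lam i * ⟪e i, f⟫) • e i) (integralOperator μ hk f)

end Embedding

/-- Polynomial eigenvalue decay of rate `β`: `c₁ i^{-β} ≤ λ_i ≤ c₂ i^{-β}` for `i = 1, 2, …`. -/
def EigenvalueDecay (β c₁ c₂ : ℝ) (lam : ℕ → ℝ) : Prop :=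
  ∀ i : ℕ, c₁ * ((i : ℝ) + 1) ^ (-β) ≤ lam i ∧ lam i ≤ c₂ * ((i : ℝ) + 1) ^ (-β)

section Model

variable {X : Type*} [MeasurableSpace X] {μ : Measure X}

/-- The norm of `f` in the interpolation space
`[H]^s = {∑ a_i λ_i^{s/2} e_i : a ∈ ℓ²}`, which is `‖a‖_{ℓ²}` for the (unique) such `a`;
it is `∞` when `f ∉ [H]^s`. -/
def powerNorm (lam : ℕ → ℝ) (e : ℕ → Lp ℝ 2 μ) (s : ℝ) (f : Lp ℝ 2 μ) : ℝ≥0∞ :=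
  ⨅ (a : lp (fun _ : ℕ => ℝ) 2) (_ : HasSum (fun i => (a i * lam i ^ (s / 2)) • e i) f), ‖a‖ₑ

/-- The conditional mean `f*_ρ(x) = ∫ y dρ(y|x)`. -/
def condMean (ρ : Measure (X × ℝ)) [IsFiniteMeasure ρ] (x : X) : ℝ :=
  ∫ y, y ∂(ρ.condKernel x)

/-- The distributions `ρ` on `X × ℝ` with finite second moment of `y` and marginal `μ`, whose
conditional mean lies in the ball of radius `R` of `[H]^s`, and whose noise satisfies the
Bernstein moment condition with constants `σ`, `L`. -/
structure InModel (lam : ℕ → ℝ) (e : ℕ → Lp ℝ 2 μ) (s R σ L : ℝ)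
    (ρ : Measure (X × ℝ)) [IsProbabilityMeasure ρ] : Prop where
  marginal : ρ.fst = μ
  secondMoment : Integrable (fun p : X × ℝ => p.2 ^ 2) ρ
  source : ∃ f : Lp ℝ 2 μ, f =ᵐ[μ] condMean ρ ∧ powerNorm lam e s f ≤ ENNReal.ofReal R
  moment : ∀ m : ℕ, 2 ≤ m → ∀ᵐ x ∂μ,
    ∫⁻ y, ENNReal.ofReal (|y - condMean ρ x| ^ m) ∂(ρ.condKernel x) ≤
      ENNReal.ofReal (1 / 2 * (m.factorial : ℝ) * σ ^ 2 * L ^ (m - 2))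

end Model

end

end SpectralLower

/-! The regression functions are restricted to a hypercube. For `N = 8 * k`, put coefficient `0` or
`√ε` on each of the eigenfunctions `e N, …, e (2 * N - 1)`, with Gaussian noise. On this block all
eigenvalues are of order `N ^ (-β)`, so the source condition reads `N ^ (β * s + 1) * ε ≲ 1`, and
two hypotheses at Hamming distance of order `N` differ in squared `[H]^γ`-norm by order `N ^ (β * γ
+ 1) * ε`. Taking `ε ≍ δ * N ^ (-(s * β + 1))` and `N ≍ n ^ (1 / (s * β + 1))` gives the stated
rate.

Testing uses the whole cube instead of a separated subset. Accept `θ` when its loss is below a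
threshold. Hypotheses accepted on the same sample are within Hamming distance `k`, and such a family
is at most a fraction `10 ^ (-k)` of the cube (`card_mul_ten_pow_le`). Hence, under pure noise, the
average acceptance probability is at most `10 ^ (-k)`. Passing to the law with signal costs a factor
`exp k` and a remainder (`pi_gaussianModel_le`). As `exp 1 < 10`, the main term vanishes for large
`k`. The remainder contains a Markov bound proportional to `n * ε`, and keeping it below `δ / 2` is
why `ε`, and so the final bound, is linear in `δ`. -/

namespace SpectralLower

open scoped NNReal

/-! ### Densities and truncated change of measure on product spaces. -/

section ProductMeasures

variable {ι α : Type*} [Fintype ι] [MeasurableSpace α]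

theorem lintegral_pi_prod (P : Measure α) [IsProbabilityMeasure P] {g : ι → α → ℝ≥0∞}
    (hg : ∀ i, Measurable (g i)) :
    ∫⁻ z, ∏ i, g i (z i) ∂(Measure.pi fun _ : ι => P) = ∏ i, ∫⁻ x, g i x ∂P := by
  rw [lintegral_prod_eq_prod_lintegral_of_indepFun Finset.univ (fun i (z : ι → α) => g i (z i))
    (iIndepFun_pi fun i => (hg i).aemeasurable) fun i => (hg i).comp (measurable_pi_apply i)]
  refine Finset.prod_congr rfl fun i _ => ?_
  exact (measurePreserving_eval (fun _ : ι => P) i).lintegral_comp (hg i)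

theorem pi_withDensity (P : Measure α) [IsProbabilityMeasure P] {g : α → ℝ≥0∞}
    (hg : Measurable g) [IsProbabilityMeasure (P.withDensity g)] :
    Measure.pi (fun _ : ι => P.withDensity g) =
      (Measure.pi fun _ : ι => P).withDensity fun z => ∏ i, g (z i) := by
  refine Measure.pi_eq fun s hs => ?_
  rw [withDensity_apply _ (MeasurableSet.univ_pi hs),
    ← lintegral_indicator (MeasurableSet.univ_pi hs)]
  have key : (Set.univ.pi s).indicator (fun z : ι → α => ∏ i, g (z i)) =
      fun z => ∏ i, (s i).indicator g (z i) := by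
    funext z
    by_cases hz : z ∈ Set.univ.pi s
    · rw [Set.indicator_of_mem hz]
      exact Finset.prod_congr rfl fun i _ => (Set.indicator_of_mem (hz i trivial) g).symm
    · rw [Set.indicator_of_notMem hz]
      obtain ⟨i, hi⟩ : ∃ i, z i ∉ s i := by simpa [Set.mem_univ_pi] using hz
      exact (Finset.prod_eq_zero (Finset.mem_univ i) (Set.indicator_of_notMem hi g)).symm
  rw [key, lintegral_pi_prod P fun i => hg.indicator (hs i)]
  refine Finset.prod_congr rfl fun i _ => ?_
  rw [lintegral_indicator (hs i), withDensity_apply _ (hs i)]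

/-- Truncating the likelihood ratio at `T` requires no divergence: only its upper tail under the new
law has to be controlled. -/
theorem withDensity_le_mul_add (P : Measure α) {G : α → ℝ≥0∞} (hG : Measurable G) (T : ℝ≥0∞)
    {A : Set α} (hA : MeasurableSet A) :
    P.withDensity G A ≤ T * P A + P.withDensity G {z | T < G z} := by
  have hT : MeasurableSet {z | T < G z} := measurableSet_lt measurable_const hG
  have h1 : P.withDensity G (A \ {z | T < G z}) ≤ T * P A := by
    rw [withDensity_apply _ (hA.diff hT)]
    calc ∫⁻ z in A \ {z | T < G z}, G z ∂P ≤ ∫⁻ _ in A \ {z | T < G z}, T ∂P :=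
          setLIntegral_mono measurable_const fun z hz => not_lt.1 hz.2
      _ = T * P (A \ {z | T < G z}) := by rw [setLIntegral_const]
      _ ≤ T * P A := by gcongr; exact Set.sdiff_subset
  calc P.withDensity G A ≤ P.withDensity G ((A \ {z | T < G z}) ∪ {z | T < G z}) :=
        measure_mono (by rw [Set.sdiff_union_self]; exact Set.subset_union_left)
    _ ≤ _ := measure_union_le _ _
    _ ≤ _ := by gcongr

end ProductMeasures

/-! ### Gaussian shifts and absolute moments. -/

section Gaussian

theorem gaussianReal_add_eq_withDensity (m a : ℝ) {v : ℝ≥0} (hv : v ≠ 0) :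
    gaussianReal (m + a) v = (gaussianReal m v).withDensity fun y =>
      ENNReal.ofReal (Real.exp (a * (y - m) / v - a ^ 2 / (2 * v))) := by
  rw [gaussianReal_of_var_ne_zero _ hv, gaussianReal_of_var_ne_zero _ hv,
    ← withDensity_mul _ (measurable_gaussianPDF m v) (by fun_prop)]
  congr 1
  funext y
  have hv' : (v : ℝ) ≠ 0 := by exact_mod_cast hv
  rw [Pi.mul_apply, gaussianPDF, gaussianPDF, ← ENNReal.ofReal_mul (gaussianPDFReal_nonneg _ _ _),
    gaussianPDFReal, gaussianPDFReal, mul_assoc (√(2 * Real.pi * v))⁻¹, ← Real.exp_add]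
  congr 3
  field_simp
  ring

theorem lintegral_exp_gaussianReal (m a : ℝ) {v : ℝ≥0} (hv : v ≠ 0) :
    ∫⁻ y, ENNReal.ofReal (Real.exp (a * (y - m) / v - a ^ 2 / (2 * v))) ∂gaussianReal m v = 1 := by
  have h := measure_univ (μ := gaussianReal (m + a) v)
  rwa [gaussianReal_add_eq_withDensity m a hv, withDensity_apply _ MeasurableSet.univ,
    Measure.restrict_univ] at h

/-- With `u = (y - m) / τ`, one has `|u| ^ p / p! ≤ exp |u| ≤ exp u + exp (-u)`. Each exponential
has mean `exp (1 / 2)`, and `2 * exp (1 / 2) ≤ 4`. -/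
theorem lintegral_abs_sub_pow_gaussianReal_le (m : ℝ) {τ : ℝ} (hτ : 0 < τ) (p : ℕ) :
    ∫⁻ y, ENNReal.ofReal (|y - m| ^ p) ∂gaussianReal m (τ ^ 2).toNNReal ≤
      ENNReal.ofReal (4 * p.factorial * τ ^ p) := by
  set v := (τ ^ 2).toNNReal with hvdef
  have hv : (v : ℝ) = τ ^ 2 := Real.coe_toNNReal _ (by positivity)
  have hv0 : v ≠ 0 := by
    have : (v : ℝ) ≠ 0 := by rw [hv]; positivity
    exact_mod_cast this
  set E : ℝ → ℝ → ℝ≥0∞ := fun a y => ENNReal.ofReal (Real.exp (a * (y - m) / v - a ^ 2 / (2 * v)))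
    with hE
  have hEm : ∀ a, Measurable (E a) := fun a => by simp only [hE]; fun_prop
  -- The factor `exp (1 / 2)` undoes the normalisation: `E (±τ) y` is `exp (±(y - m) / τ - 1 / 2)`.
  set c : ℝ := p.factorial * τ ^ p * Real.exp (1 / 2) with hc
  have hc0 : 0 ≤ c := by positivity
  have hpt : ∀ y, ENNReal.ofReal (|y - m| ^ p) ≤ ENNReal.ofReal c * (E τ y + E (-τ) y) := by
    intro y
    rw [hE]
    simp only
    rw [← ENNReal.ofReal_add (Real.exp_nonneg _) (Real.exp_nonneg _), ← ENNReal.ofReal_mul hc0]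
    refine ENNReal.ofReal_le_ofReal ?_
    have h1 := Real.pow_div_factorial_le_exp (|y - m| / τ) (by positivity) p
    have h2 : |y - m| ^ p ≤ p.factorial * τ ^ p * Real.exp (|y - m| / τ) := by
      have : |y - m| ^ p = p.factorial * τ ^ p * ((|y - m| / τ) ^ p / p.factorial) := by
        have : (p.factorial : ℝ) ≠ 0 := by positivity
        rw [div_pow]
        field_simp
      rw [this]
      gcongr
    refine h2.trans ?_
    rw [hc, mul_assoc _ (Real.exp (1 / 2)), mul_add, ← Real.exp_add, ← Real.exp_add, hv]
    gcongr
    have e1 : 1 / 2 + (τ * (y - m) / τ ^ 2 - τ ^ 2 / (2 * τ ^ 2)) = (y - m) / τ := by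
      field_simp; ring
    have e2 : 1 / 2 + (-τ * (y - m) / τ ^ 2 - (-τ) ^ 2 / (2 * τ ^ 2)) = -(y - m) / τ := by
      field_simp; ring
    rw [e1, e2]
    rcases abs_cases (y - m) with h | h <;> rw [h.1]
    · linarith [Real.exp_pos (-(y - m) / τ)]
    · linarith [Real.exp_pos ((y - m) / τ)]
  calc ∫⁻ y, ENNReal.ofReal (|y - m| ^ p) ∂gaussianReal m v
      ≤ ∫⁻ y, ENNReal.ofReal c * (E τ y + E (-τ) y) ∂gaussianReal m v := lintegral_mono hpt
    _ = ENNReal.ofReal c * (1 + 1) := by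
        rw [lintegral_const_mul (f := fun y => E τ y + E (-τ) y) _ ((hEm _).add (hEm _)),
          lintegral_add_left (hEm _),
          lintegral_exp_gaussianReal m τ hv0, lintegral_exp_gaussianReal m (-τ) hv0]
    _ ≤ ENNReal.ofReal (4 * p.factorial * τ ^ p) := by
        rw [show (1 + 1 : ℝ≥0∞) = ENNReal.ofReal 2 by norm_num, ← ENNReal.ofReal_mul hc0]
        refine ENNReal.ofReal_le_ofReal ?_
        have h3 : Real.exp (1 / 2) ≤ 2 := by
          have h4 : Real.exp (1 / 2) ^ 2 ≤ 2 ^ 2 := by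
            rw [← Real.exp_nat_mul]
            norm_num
            linarith [Real.exp_one_lt_d9]
          exact (pow_le_pow_iff_left₀ (Real.exp_nonneg _) (by norm_num) two_ne_zero).1 h4
        have h5 : 0 ≤ (p.factorial : ℝ) * τ ^ p := by positivity
        rw [hc]
        nlinarith

end Gaussian

/-! ### Regression with Gaussian noise: conditional law, moments, likelihood ratio. -/

section RegressionModel

variable {X : Type*} [MeasurableSpace X]

/-- The Markov kernel `x ↦ N(f x, v)`. -/
noncomputable def gaussianKernel (f : X → ℝ) (hf : Measurable f) (v : ℝ≥0) : Kernel X ℝ :=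
  ⟨fun x => gaussianReal (f x) v,
    measurable_gaussianReal.comp (hf.prodMk measurable_const)⟩

@[simp]
theorem gaussianKernel_apply (f : X → ℝ) (hf : Measurable f) (v : ℝ≥0) (x : X) :
    gaussianKernel f hf v x = gaussianReal (f x) v := rfl

instance (f : X → ℝ) (hf : Measurable f) (v : ℝ≥0) : IsMarkovKernel (gaussianKernel f hf v) :=
  ⟨fun x => by rw [gaussianKernel_apply]; infer_instance⟩

/-- The law of `(x, y)` with `x ∼ μ` and `y = f x + N(0, v)`. -/
noncomputable def gaussianModel (μ : Measure X) (f : X → ℝ) (hf : Measurable f) (v : ℝ≥0) :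
    Measure (X × ℝ) :=
  μ ⊗ₘ gaussianKernel f hf v

variable (μ : Measure X) [IsProbabilityMeasure μ] (f : X → ℝ) (hf : Measurable f) {v : ℝ≥0}

instance : IsProbabilityMeasure (gaussianModel μ f hf v) := by
  unfold gaussianModel; infer_instance

theorem gaussianModel_eq_withDensity (hv : v ≠ 0) :
    gaussianModel μ f hf v = (gaussianModel μ 0 measurable_zero v).withDensity fun p =>
      ENNReal.ofReal (Real.exp (f p.1 * p.2 / v - f p.1 ^ 2 / (2 * v))) := by
  have hm : Measurable (Function.uncurry fun (x : X) (y : ℝ) =>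
      ENNReal.ofReal (Real.exp (f x * y / v - f x ^ 2 / (2 * v)))) := by
    unfold Function.uncurry; fun_prop
  have hk : gaussianKernel f hf v = (gaussianKernel (0 : X → ℝ) measurable_zero v).withDensity
      fun x y => ENNReal.ofReal (Real.exp (f x * y / v - f x ^ 2 / (2 * v))) := by
    ext1 x
    rw [Kernel.withDensity_apply _ hm, gaussianKernel_apply, gaussianKernel_apply]
    simpa using gaussianReal_add_eq_withDensity 0 (f x) hv
  have hs : IsSFiniteKernel ((gaussianKernel (0 : X → ℝ) measurable_zero v).withDensity
      fun x y => ENNReal.ofReal (Real.exp (f x * y / v - f x ^ 2 / (2 * v)))) := by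
    rw [← hk]; infer_instance
  rw [gaussianModel, hk, Measure.compProd_withDensity hm, gaussianModel]

theorem fst_gaussianModel : (gaussianModel μ f hf v).fst = μ := by
  rw [gaussianModel, Measure.fst_compProd]

theorem condKernel_gaussianModel :
    ∀ᵐ x ∂μ, (gaussianModel μ f hf v).condKernel x = gaussianReal (f x) v := by
  have h := eq_condKernel_of_measure_eq_compProd (ρ := gaussianModel μ f hf v)
    (gaussianKernel f hf v) (by rw [fst_gaussianModel, gaussianModel])
  rw [fst_gaussianModel] at h
  filter_upwards [h] with x hx
  rw [← hx, gaussianKernel_apply]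

theorem condMean_gaussianModel : condMean (gaussianModel μ f hf v) =ᵐ[μ] f := by
  filter_upwards [condKernel_gaussianModel μ f hf (v := v)] with x hx
  rw [condMean, hx, integral_id_gaussianReal]

theorem lintegral_fst_gaussianModel {g : X → ℝ≥0∞} (hg : Measurable g) :
    ∫⁻ p, g p.1 ∂gaussianModel μ f hf v = ∫⁻ x, g x ∂μ := by
  rw [gaussianModel, Measure.lintegral_compProd (f := fun p => g p.1) (hg.comp measurable_fst)]
  simp

theorem integrable_sq_snd_gaussianModel {τ : ℝ} (hτ : 0 < τ) (hf2 : MemLp f 2 μ) :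
    Integrable (fun p : X × ℝ => p.2 ^ 2) (gaussianModel μ f hf (τ ^ 2).toNNReal) := by
  have h1 : Integrable (fun p : X × ℝ => f p.1 ^ 2) (gaussianModel μ f hf (τ ^ 2).toNNReal) := by
    refine ⟨Measurable.aestronglyMeasurable (by fun_prop), ?_⟩
    have := hf2.integrable_sq.2
    rw [hasFiniteIntegral_iff_enorm] at this ⊢
    rwa [lintegral_fst_gaussianModel μ f hf (g := fun x => ‖f x ^ 2‖ₑ) (by fun_prop)]
  have h2 : Integrable (fun p : X × ℝ => (p.2 - f p.1) ^ 2)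
      (gaussianModel μ f hf (τ ^ 2).toNNReal) := by
    refine ⟨by fun_prop, ?_⟩
    rw [hasFiniteIntegral_iff_ofReal (Filter.Eventually.of_forall fun p => sq_nonneg _),
      gaussianModel, Measure.lintegral_compProd (by fun_prop)]
    calc ∫⁻ x, ∫⁻ y, ENNReal.ofReal ((y - f x) ^ 2) ∂gaussianKernel f hf (τ ^ 2).toNNReal x ∂μ
        ≤ ∫⁻ _, ENNReal.ofReal (4 * (2 : ℕ).factorial * τ ^ 2) ∂μ := by
          refine lintegral_mono fun x => ?_
          have := lintegral_abs_sub_pow_gaussianReal_le (f x) hτ 2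
          simp only [sq_abs] at this
          exact this
      _ < ∞ := by rw [lintegral_const, measure_univ, mul_one]; exact ENNReal.ofReal_lt_top
  refine Integrable.mono' ((h1.add h2).const_mul 2) (by fun_prop) (.of_forall fun p => ?_)
  rw [Real.norm_of_nonneg (sq_nonneg _), Pi.add_apply]
  nlinarith [sq_nonneg (p.2 - 2 * f p.1)]

/-- Change of measure from the pure-noise model, with explicit control of the likelihood ratio. -/
theorem pi_gaussianModel_le (hv : v ≠ 0) (n : ℕ) {A : Set (Fin n → X × ℝ)} (hA : MeasurableSet A)
    {t : ℝ} (ht : 0 < t) :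
    Measure.pi (fun _ : Fin n => gaussianModel μ f hf v) A ≤
      ENNReal.ofReal (Real.exp t) *
          Measure.pi (fun _ : Fin n => gaussianModel μ 0 measurable_zero v) A +
        (n * (∫⁻ x, ENNReal.ofReal (f x ^ 2 / v) ∂μ) / ENNReal.ofReal (t / 2) +
          ENNReal.ofReal (Real.exp (-(t / 2)))) := by
  set P := gaussianModel μ f hf v with hP
  set P₀ := gaussianModel μ 0 measurable_zero v with hP₀
  set g : X × ℝ → ℝ≥0∞ := fun p =>
    ENNReal.ofReal (Real.exp (f p.1 * p.2 / v - f p.1 ^ 2 / (2 * v))) with hg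
  have hgm : Measurable g := by rw [hg]; fun_prop
  have hPd : P = P₀.withDensity g := gaussianModel_eq_withDensity μ f hf hv
  have hpr : IsProbabilityMeasure (P₀.withDensity g) := by rw [← hPd]; infer_instance
  have hpi : Measure.pi (fun _ : Fin n => P) =
      (Measure.pi fun _ : Fin n => P₀).withDensity fun z => ∏ i, g (z i) := by
    rw [hPd]; exact pi_withDensity P₀ hgm
  have hGm : Measurable fun z : Fin n → X × ℝ => ∏ i, g (z i) :=
    Finset.measurable_prod _ fun i _ => hgm.comp (measurable_pi_apply i)
  have h1 := withDensity_le_mul_add (Measure.pi fun _ : Fin n => P₀) hGm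
    (ENNReal.ofReal (Real.exp t)) hA
  rw [← hpi] at h1
  refine h1.trans (add_le_add le_rfl ?_)
  -- Recentring `y` at its mean under `P` splits the log-likelihood ratio into `∑ f² / v`, which
  -- depends on the design only, and `∑ w`, whose exponential has mean one under `P`. If the total
  -- exceeds `t`, one of the two parts is at least `t / 2`, and Markov's inequality applies to each.
  set w : X × ℝ → ℝ := fun p => f p.1 * (p.2 - f p.1) / v - f p.1 ^ 2 / (2 * v) with hw
  have hwm : Measurable w := by rw [hw]; fun_prop
  have hv' : (0 : ℝ) < v := by exact_mod_cast pos_iff_ne_zero.2 hv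
  have hsub : {z : Fin n → X × ℝ | ENNReal.ofReal (Real.exp t) < ∏ i, g (z i)} ⊆
      {z | ENNReal.ofReal (t / 2) ≤ ∑ i, ENNReal.ofReal (f (z i).1 ^ 2 / v)} ∪
      {z | ENNReal.ofReal (Real.exp (t / 2)) ≤ ∏ i, ENNReal.ofReal (Real.exp (w (z i)))} := by
    intro z hz
    simp only [Set.mem_ofPred_eq, Set.mem_union] at hz ⊢
    rw [← ENNReal.ofReal_sum_of_nonneg fun i _ => by positivity,
      ← ENNReal.ofReal_prod_of_nonneg fun i _ => Real.exp_nonneg _, ← Real.exp_sum,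
      ENNReal.ofReal_le_ofReal_iff (Finset.sum_nonneg fun i _ => by positivity),
      ENNReal.ofReal_le_ofReal_iff (Real.exp_nonneg _), Real.exp_le_exp]
    rw [hg, ← ENNReal.ofReal_prod_of_nonneg fun i _ => Real.exp_nonneg _, ← Real.exp_sum,
      ENNReal.ofReal_lt_ofReal_iff (Real.exp_pos _), Real.exp_lt_exp] at hz
    have e : ∑ i, (f (z i).1 * (z i).2 / v - f (z i).1 ^ 2 / (2 * v)) =
        ∑ i, f (z i).1 ^ 2 / v + ∑ i, w (z i) := by
      rw [← Finset.sum_add_distrib]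
      refine Finset.sum_congr rfl fun i _ => ?_
      rw [hw]
      field_simp
      ring
    rw [e] at hz
    by_contra! hcon
    linarith [hcon.1, hcon.2]
  refine (measure_mono hsub).trans ((measure_union_le _ _).trans (add_le_add ?_ ?_))
  · refine (meas_ge_le_lintegral_div (Measurable.aemeasurable (by fun_prop)) (by simpa using ht) ENNReal.ofReal_ne_top).trans
      ?_
    gcongr
    rw [lintegral_finsetSum _ fun i _ => by fun_prop]
    have : ∀ i : Fin n, ∫⁻ z : Fin n → X × ℝ, ENNReal.ofReal (f (z i).1 ^ 2 / v)
        ∂(Measure.pi fun _ : Fin n => P) = ∫⁻ x, ENNReal.ofReal (f x ^ 2 / v) ∂μ := by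
      intro i
      rw [(measurePreserving_eval (fun _ : Fin n => P) i).lintegral_comp
        (f := fun p : X × ℝ => ENNReal.ofReal (f p.1 ^ 2 / v)) (by fun_prop)]
      exact lintegral_fst_gaussianModel μ f hf (g := fun x => ENNReal.ofReal (f x ^ 2 / v))
        (by fun_prop)
    simp [this]
  · refine (meas_ge_le_lintegral_div (Measurable.aemeasurable (by fun_prop)) (by simpa using Real.exp_pos _)
      ENNReal.ofReal_ne_top).trans ?_
    rw [lintegral_pi_prod P (g := fun _ p => ENNReal.ofReal (Real.exp (w p)))
      fun _ => by fun_prop]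
    -- Given `x`, `exp w` is the density of `N(2 f x, v)` with respect to `N(f x, v)`.
    have : ∫⁻ p, ENNReal.ofReal (Real.exp (w p)) ∂P = 1 := by
      rw [hP, gaussianModel, Measure.lintegral_compProd (by fun_prop)]
      simp only [gaussianKernel_apply, hw]
      simp [lintegral_exp_gaussianReal _ _ hv]
    rw [this, Finset.prod_const_one, Real.exp_neg, ENNReal.ofReal_inv_of_pos (Real.exp_pos _),
      one_div]

end RegressionModel

/-! ### Counting on the hypercube and the testing bound. -/

section Hypercube

theorem sum_pow_hammingDist {N : ℕ} (θ₀ : Fin N → Bool) (x : ℝ) :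
    ∑ θ : Fin N → Bool, x ^ hammingDist θ θ₀ = (1 + x) ^ N := by
  have h1 : ∀ θ : Fin N → Bool, x ^ hammingDist θ θ₀ = ∏ i, if θ i = θ₀ i then 1 else x := by
    intro θ
    rw [Finset.prod_ite, Finset.prod_const_one, one_mul, Finset.prod_const, hammingDist]
  have h2 : ∀ i, ∑ b : Bool, (if b = θ₀ i then 1 else x) = 1 + x := by
    intro i
    cases θ₀ i <;> simp [add_comm]
  simp_rw [h1]
  have h3 := Finset.prod_univ_sum (fun _ : Fin N => (Finset.univ : Finset Bool))
    (fun i b => if b = θ₀ i then 1 else x)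
  rw [Fintype.piFinset_univ] at h3
  rw [← h3]
  simp only [h2, Finset.prod_const, Finset.card_univ, Fintype.card_fin]

/-- A set of Hamming diameter at most an eighth of the dimension is exponentially small. -/
theorem card_mul_ten_pow_le {k : ℕ} (S : Finset (Fin (8 * k) → Bool))
    (hS : ∀ θ ∈ S, ∀ θ' ∈ S, hammingDist θ θ' ≤ k) : (S.card : ℝ) * 10 ^ k ≤ 2 ^ (8 * k) := by
  rcases S.eq_empty_or_nonempty with rfl | ⟨θ₀, h₀⟩
  · simp
  -- A Chernoff-type count: `S` lies in the Hamming ball of radius `k` about any of its points,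
  -- where the weight `(1 / 4) ^ hammingDist` is at least `(1 / 4) ^ k`.
  have h1 : (S.card : ℝ) * (1 / 4) ^ k ≤ (5 / 4) ^ (8 * k) := by
    calc (S.card : ℝ) * (1 / 4) ^ k = ∑ _θ ∈ S, (1 / 4 : ℝ) ^ k := by simp
      _ ≤ ∑ θ ∈ S, (1 / 4 : ℝ) ^ hammingDist θ θ₀ :=
          Finset.sum_le_sum fun θ hθ =>
            pow_le_pow_of_le_one (by norm_num) (by norm_num) (hS θ hθ θ₀ h₀)
      _ ≤ ∑ θ, (1 / 4 : ℝ) ^ hammingDist θ θ₀ :=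
          Finset.sum_le_univ_sum_of_nonneg fun θ => by positivity
      _ = (5 / 4) ^ (8 * k) := by rw [sum_pow_hammingDist]; norm_num
  calc (S.card : ℝ) * 10 ^ k = (S.card * (1 / 4) ^ k) * 40 ^ k := by
        rw [mul_assoc, ← mul_pow]; norm_num
    _ ≤ (5 / 4) ^ (8 * k) * 40 ^ k := by gcongr
    _ = ((5 / 4) ^ 8 * 40) ^ k := by rw [pow_mul, ← mul_pow]
    -- `(5 / 4) ^ 8 * 40 ≈ 238.4 < 256`; this leaves room for the base `10`, which only needs to
    -- exceed `exp 1` later.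
    _ ≤ (2 ^ 8) ^ k := by gcongr; norm_num
    _ = 2 ^ (8 * k) := by rw [pow_mul]

/-- A Fano-type bound over the hypercube: if acceptance regions only overlap for hypotheses at
Hamming distance at most `k`, then some hypothesis is rarely accepted. -/
theorem exists_measure_le_of_hammingDist {Ω : Type*} [MeasurableSpace Ω] {k : ℕ}
    (P : (Fin (8 * k) → Bool) → Measure Ω) (Q : Measure Ω) [IsProbabilityMeasure Q]
    (B : (Fin (8 * k) → Bool) → Set Ω) (hB : ∀ θ, MeasurableSet (B θ)) (T η : ℝ≥0∞)
    (hPQ : ∀ θ, P θ (B θ) ≤ T * Q (B θ) + η)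
    (hd : ∀ z θ θ', z ∈ B θ → z ∈ B θ' → hammingDist θ θ' ≤ k) :
    ∃ θ, P θ (B θ) ≤ T * ENNReal.ofReal ((1 / 10) ^ k) + η := by
  classical
  -- Exchanging sum and integral, the left side is the `Q`-mean of the number of hypotheses accepted
  -- at `z`, to which the counting bound applies pointwise.
  have hQ : ∑ θ, Q (B θ) ≤ ∑ _θ : Fin (8 * k) → Bool, ENNReal.ofReal ((1 / 10) ^ k) := by
    have e1 : ∑ _θ : Fin (8 * k) → Bool, ENNReal.ofReal ((1 / 10) ^ k) =
        ENNReal.ofReal (2 ^ (8 * k) * (1 / 10) ^ k) := by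
      rw [Finset.sum_const, nsmul_eq_mul, ENNReal.ofReal_mul (by positivity)]
      congr 1
      rw [ENNReal.ofReal_pow (by norm_num)]
      simp
    have e2 : ∑ θ, Q (B θ) = ∫⁻ z, ∑ θ, (B θ).indicator 1 z ∂Q := by
      rw [lintegral_finsetSum _ fun θ _ => measurable_one.indicator (hB θ)]
      exact Finset.sum_congr rfl fun θ _ => (lintegral_indicator_one (hB θ)).symm
    rw [e1, e2]
    calc ∫⁻ z, ∑ θ, (B θ).indicator 1 z ∂Q
        ≤ ∫⁻ _, ENNReal.ofReal (2 ^ (8 * k) * (1 / 10) ^ k) ∂Q := by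
          refine lintegral_mono fun z => ?_
          have e3 : ∑ θ, (B θ).indicator (1 : Ω → ℝ≥0∞) z =
              ENNReal.ofReal (Finset.univ.filter fun θ => z ∈ B θ).card := by
            simp [Set.indicator_apply]
          simp only [e3]
          refine ENNReal.ofReal_le_ofReal ?_
          have h := card_mul_ten_pow_le (Finset.univ.filter fun θ => z ∈ B θ) fun θ hθ θ' hθ' =>
            hd z θ θ' (Finset.mem_filter.1 hθ).2 (Finset.mem_filter.1 hθ').2
          rw [one_div, inv_pow, ← div_eq_mul_inv, le_div_iff₀ (by positivity)]
          exact h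
      _ = _ := by rw [lintegral_const, measure_univ, mul_one]
  have hsum : ∑ θ, P θ (B θ) ≤
      ∑ _θ : Fin (8 * k) → Bool, (T * ENNReal.ofReal ((1 / 10) ^ k) + η) := by
    calc ∑ θ, P θ (B θ) ≤ ∑ θ, (T * Q (B θ) + η) := Finset.sum_le_sum fun θ _ => hPQ θ
      _ = T * ∑ θ, Q (B θ) + ∑ _θ : Fin (8 * k) → Bool, η := by
          rw [Finset.sum_add_distrib, Finset.mul_sum]
      _ ≤ T * (∑ _θ : Fin (8 * k) → Bool, ENNReal.ofReal ((1 / 10) ^ k)) +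
          ∑ _θ : Fin (8 * k) → Bool, η := by gcongr
      _ = _ := by rw [Finset.sum_add_distrib, Finset.mul_sum]
  by_contra! hcon
  exact absurd hsum (not_le.2 (ENNReal.sum_lt_sum_of_nonempty Finset.univ_nonempty
    fun θ _ => hcon θ))

end Hypercube

/-! ### Interpolation norms in coordinates. -/

section PowerNorm

variable {X : Type*} [MeasurableSpace X] {μ : Measure X} {lam : ℕ → ℝ} {e : ℕ → Lp ℝ 2 μ}

theorem powerNorm_sum_smul_le (hpos : ∀ i, 0 < lam i) (I : Finset ℕ) (F : ℕ → ℝ) (s : ℝ) {R : ℝ}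
    (hR : 0 ≤ R) (h : ∑ i ∈ I, lam i ^ (-s) * F i ^ 2 ≤ R ^ 2) :
    powerNorm lam e s (∑ i ∈ I, F i • e i) ≤ ENNReal.ofReal R := by
  set a : lp (fun _ : ℕ => ℝ) 2 := ∑ i ∈ I, lp.single 2 i (F i * lam i ^ (-(s / 2))) with ha
  have hai : ∀ i, a i = if i ∈ I then F i * lam i ^ (-(s / 2)) else 0 := by
    intro i
    simp only [ha, lp.coeFn_single, lp.coeFn_sum, Finset.sum_apply, Finset.sum_pi_single]
  have hsum : HasSum (fun i => (a i * lam i ^ (s / 2)) • e i) (∑ i ∈ I, F i • e i) := by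
    have h1 : ∑ i ∈ I, F i • e i = ∑ i ∈ I, (a i * lam i ^ (s / 2)) • e i := by
      refine Finset.sum_congr rfl fun i hi => ?_
      rw [hai, if_pos hi, mul_assoc, ← Real.rpow_add (hpos i), neg_add_cancel, Real.rpow_zero,
        mul_one]
    rw [h1]
    refine hasSum_sum_of_ne_finset_zero fun i hi => ?_
    rw [hai, if_neg hi, zero_mul, zero_smul]
  have hnorm : ‖a‖ ≤ R := by
    have h2 := lp.norm_sum_single (p := 2) (E := fun _ : ℕ => ℝ) (by norm_num)
      (fun i => F i * lam i ^ (-(s / 2))) I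
    rw [← ha] at h2
    have h3 : ‖a‖ ^ 2 ≤ R ^ 2 := by
      refine le_trans (le_of_eq ?_) h
      rw [ENNReal.toReal_ofNat, Real.rpow_two] at h2
      rw [h2]
      refine Finset.sum_congr rfl fun i _ => ?_
      rw [Real.rpow_two, Real.norm_eq_abs, sq_abs, mul_pow, ← Real.rpow_natCast (lam i ^ _) 2,
        ← Real.rpow_mul (hpos i).le, mul_comm]
      congr 2
      push_cast
      ring
    exact (pow_le_pow_iff_left₀ (norm_nonneg _) hR two_ne_zero).1 h3
  calc powerNorm lam e s (∑ i ∈ I, F i • e i) ≤ ‖a‖ₑ := iInf₂_le a hsum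
    _ ≤ ENNReal.ofReal R := by
        rw [← ofReal_norm]
        exact ENNReal.ofReal_le_ofReal hnorm

/-- Orthonormality forces the coefficients of every admissible representation of `g`, so the partial
sum is bounded by its `ℓ²` norm. Outside `[H]^γ` the infimum is over an empty family and nothing
needs proof. -/
theorem le_powerNorm_sq (hpos : ∀ i, 0 < lam i) (he : Orthonormal ℝ e) (I : Finset ℕ) (γ : ℝ)
    (g : Lp ℝ 2 μ) :
    ENNReal.ofReal (∑ i ∈ I, lam i ^ (-γ) * ⟪e i, g⟫ ^ 2) ≤ powerNorm lam e γ g ^ 2 := by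
  set S := ∑ i ∈ I, lam i ^ (-γ) * ⟪e i, g⟫ ^ 2 with hS
  have key : ENNReal.ofReal (√S) ≤ powerNorm lam e γ g := by
    refine le_iInf₂ fun a ha => ?_
    rw [← ofReal_norm]
    refine ENNReal.ofReal_le_ofReal (Real.sqrt_le_iff.2 ⟨norm_nonneg _, ?_⟩)
    have hc : ∀ j, ⟪e j, g⟫ = a j * lam j ^ (γ / 2) := by
      intro j
      have h1 : HasSum (fun i => ⟪e j, (a i * lam i ^ (γ / 2)) • e i⟫) ⟪e j, g⟫ :=
        ha.mapL (innerSL ℝ (e j))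
      have h2 := h1.unique (hasSum_single j fun i hi => by
        rw [inner_smul_right, he.2 hi.symm, mul_zero])
      rw [h2, inner_smul_right, real_inner_self_eq_norm_sq, he.1 j, one_pow, mul_one]
    have h2 := lp.sum_rpow_le_norm_rpow (p := 2) (by norm_num) a I
    simp only [ENNReal.toReal_ofNat, Real.rpow_two] at h2
    refine le_trans (le_of_eq ?_) h2
    refine Finset.sum_congr rfl fun i _ => ?_
    rw [hc, Real.norm_eq_abs, sq_abs, mul_pow, ← Real.rpow_natCast (lam i ^ (γ / 2)) 2,
      ← Real.rpow_mul (hpos i).le, mul_left_comm, ← Real.rpow_add (hpos i)]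
    simp
  have hS0 : 0 ≤ S := Finset.sum_nonneg fun i _ => by
    have := hpos i
    positivity
  calc ENNReal.ofReal S = ENNReal.ofReal (√S) ^ 2 := by
        rw [← ENNReal.ofReal_pow (Real.sqrt_nonneg _), Real.sq_sqrt hS0]
    _ ≤ _ := by gcongr

theorem lintegral_ofReal_sq_div (f : Lp ℝ 2 μ) (v : ℝ) :
    ∫⁻ x, ENNReal.ofReal (f x ^ 2 / v) ∂μ = ENNReal.ofReal (‖f‖ ^ 2 / v) := by
  rcases le_total v 0 with hv | hv
  · rw [ENNReal.ofReal_of_nonpos (div_nonpos_of_nonneg_of_nonpos (sq_nonneg _) hv)]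
    simp [ENNReal.ofReal_of_nonpos (div_nonpos_of_nonneg_of_nonpos (sq_nonneg _) hv)]
  · rw [← ofReal_integral_eq_lintegral_ofReal ((Lp.memLp f).integrable_sq.div_const v)
      (.of_forall fun x => by positivity), integral_div, ← real_inner_self_eq_norm_sq, L2.inner_def]
    simp [pow_two]

end PowerNorm

/-! ### The hypercube of signals and its minimax bound. -/

section LowerBound

variable {X : Type*} [MeasurableSpace X] {μ : Measure X} {lam : ℕ → ℝ} {e : ℕ → Lp ℝ 2 μ}

/-- The law of `y = f x + ξ` with Gaussian noise `ξ` of standard deviation `τ`. -/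
noncomputable abbrev lpModel (f : Lp ℝ 2 μ) (τ : ℝ) : Measure (X × ℝ) :=
  gaussianModel μ f (Lp.stronglyMeasurable f).measurable (τ ^ 2).toNNReal

theorem inModel_lpModel [IsProbabilityMeasure μ] {s R σ L : ℝ} (hσ : 0 < σ) (hL : 0 < L) (f : Lp ℝ 2 μ)
    (hf : powerNorm lam e s f ≤ ENNReal.ofReal R) :
    InModel lam e s R σ L (lpModel f (min σ L / 3)) where
  marginal := fst_gaussianModel _ _ _
  secondMoment := integrable_sq_snd_gaussianModel μ f _ (by positivity) (Lp.memLp f)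
  source := ⟨f, (condMean_gaussianModel _ _ _).symm, hf⟩
  moment := fun m hm => by
    -- The Gaussian moment bound carries a factor `4`; dividing by `3` gives `4 / 9 ≤ 1 / 2`, while
    -- `τ ≤ L` handles the remaining `m - 2` powers.
    set τ := min σ L / 3 with hτ
    have hτ0 : 0 < τ := by positivity
    have hm' : Measurable (f : X → ℝ) := (Lp.stronglyMeasurable f).measurable
    filter_upwards [condKernel_gaussianModel μ f hm' (v := (τ ^ 2).toNNReal),
      condMean_gaussianModel μ f hm' (v := (τ ^ 2).toNNReal)] with x h1 h2
    rw [h1, h2]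
    refine (lintegral_abs_sub_pow_gaussianReal_le (f x) hτ0 m).trans
      (ENNReal.ofReal_le_ofReal ?_)
    have h3 : τ ≤ σ / 3 := by rw [hτ]; gcongr; exact min_le_left _ _
    have h4 : τ ≤ L := by
      have := min_le_right σ L
      rw [hτ]; linarith
    have h5 : τ ^ m = τ ^ 2 * τ ^ (m - 2) := by rw [← pow_add]; congr 1; omega
    calc 4 * m.factorial * τ ^ m = 4 * m.factorial * τ ^ 2 * τ ^ (m - 2) := by rw [h5]; ring
      _ ≤ 4 * m.factorial * (σ / 3) ^ 2 * L ^ (m - 2) := by gcongr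
      _ = 4 / 9 * (m.factorial * σ ^ 2 * L ^ (m - 2)) := by ring
      _ ≤ 1 / 2 * (m.factorial * σ ^ 2 * L ^ (m - 2)) :=
        mul_le_mul_of_nonneg_right (by norm_num) (by positivity)
      _ = 1 / 2 * m.factorial * σ ^ 2 * L ^ (m - 2) := by ring

/-- The regression function with coefficient `√ε` on those `e (N + i)`, `i < N`, which are
selected by `θ`. -/
noncomputable def cubeSignal (e : ℕ → Lp ℝ 2 μ) {N : ℕ} (ε : ℝ) (θ : Fin N → Bool) : Lp ℝ 2 μ :=
  ∑ i, (if θ i then √ε else 0) • e (N + i)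

theorem orthonormal_shift (he : Orthonormal ℝ e) (N : ℕ) :
    Orthonormal ℝ fun i : Fin N => e (N + i) :=
  he.comp (fun i : Fin N => N + (i : ℕ)) fun i j h => Fin.ext (by simpa using h)

theorem inner_cubeSignal (he : Orthonormal ℝ e) {N : ℕ} (ε : ℝ) (θ : Fin N → Bool) (i : Fin N) :
    ⟪e (N + i), cubeSignal e ε θ⟫ = if θ i then √ε else 0 :=
  (orthonormal_shift he N).inner_right_fintype _ i

theorem norm_sq_cubeSignal_le (he : Orthonormal ℝ e) {N : ℕ} {ε : ℝ} (hε : 0 ≤ ε)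
    (θ : Fin N → Bool) : ‖cubeSignal e ε θ‖ ^ 2 ≤ N * ε := by
  rw [← real_inner_self_eq_norm_sq]
  conv_lhs => rw [cubeSignal]
  rw [(orthonormal_shift he N).inner_sum]
  calc ∑ i, _ ≤ ∑ _i : Fin N, ε := Finset.sum_le_sum fun i _ => by
        split_ifs <;> simp [hε]
    _ = N * ε := by simp

theorem powerNorm_cubeSignal_le (hpos : ∀ i, 0 < lam i) {N : ℕ} {ε s R M : ℝ} (hε : 0 ≤ ε)
    (hR : 0 ≤ R) (hM : ∀ i : Fin N, lam (N + i) ^ (-s) ≤ M) (h : N * (M * ε) ≤ R ^ 2)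
    (θ : Fin N → Bool) : powerNorm lam e s (cubeSignal e ε θ) ≤ ENNReal.ofReal R := by
  have hinj : Function.Injective fun i : Fin N => N + (i : ℕ) :=
    fun i j h => Fin.ext (by simpa using h)
  set b : Fin N → ℝ := fun i => if θ i then √ε else 0 with hb
  set F : ℕ → ℝ := Function.extend (fun i : Fin N => N + (i : ℕ)) b 0 with hF
  have hFi : ∀ i : Fin N, F (N + i) = b i := fun i => hinj.extend_apply b 0 i
  have hsig : cubeSignal e ε θ = ∑ m ∈ Finset.univ.map ⟨_, hinj⟩, F m • e m := by
    rw [Finset.sum_map]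
    exact Finset.sum_congr rfl fun i _ => by
      simp only [Function.Embedding.coeFn_mk, hFi]
      rfl
  rw [hsig]
  refine powerNorm_sum_smul_le hpos _ F s hR ?_
  rw [Finset.sum_map]
  calc ∑ i : Fin N, _ ≤ ∑ _i : Fin N, M * ε := by
        refine Finset.sum_le_sum fun i _ => ?_
        simp only [Function.Embedding.coeFn_mk, hFi, hb]
        have h0 := Real.rpow_nonneg (hpos (N + i)).le (-s)
        refine mul_le_mul (hM i) ?_ (sq_nonneg _) (h0.trans (hM i))
        split_ifs <;> simp [hε, Real.sq_sqrt]
    _ = N * (M * ε) := by simp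
    _ ≤ R ^ 2 := h

/-- The squared `[H]^γ`-distance between `g` and a hypothesis, restricted to the coordinates
`N, …, 2 N - 1`. -/
noncomputable def cubeLoss (lam : ℕ → ℝ) (e : ℕ → Lp ℝ 2 μ) {N : ℕ} (γ ε : ℝ) (θ : Fin N → Bool)
    (g : Lp ℝ 2 μ) : ℝ :=
  ∑ i : Fin N, lam (N + i) ^ (-γ) * ⟪e (N + i), g - cubeSignal e ε θ⟫ ^ 2

theorem cubeLoss_le_powerNorm_sq (hpos : ∀ i, 0 < lam i) (he : Orthonormal ℝ e) {N : ℕ}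
    (γ ε : ℝ) (θ : Fin N → Bool) (g : Lp ℝ 2 μ) :
    ENNReal.ofReal (cubeLoss lam e γ ε θ g) ≤ powerNorm lam e γ (g - cubeSignal e ε θ) ^ 2 := by
  have hinj : Function.Injective fun i : Fin N => N + (i : ℕ) :=
    fun i j h => Fin.ext (by simpa using h)
  have h := le_powerNorm_sq hpos he (Finset.univ.map ⟨_, hinj⟩) γ (g - cubeSignal e ε θ)
  rwa [Finset.sum_map] at h

theorem measurable_cubeLoss {N : ℕ} (γ ε : ℝ) (θ : Fin N → Bool) {Ω : Type*} [MeasurableSpace Ω]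
    {g : Ω → Lp ℝ 2 μ} (hg : StronglyMeasurable g) :
    Measurable fun z => cubeLoss lam e γ ε θ (g z) := by
  have hc : Continuous (cubeLoss lam e γ ε θ) := by unfold cubeLoss; fun_prop
  exact (hc.comp_stronglyMeasurable hg).measurable

theorem mul_hammingDist_le (hpos : ∀ i, 0 < lam i) (he : Orthonormal ℝ e) {N : ℕ} {γ ε κ : ℝ}
    (hε : 0 ≤ ε) (hκ : ∀ i : Fin N, κ ≤ lam (N + i) ^ (-γ)) (θ θ' : Fin N → Bool)
    (g : Lp ℝ 2 μ) :
    κ * ε * hammingDist θ θ' ≤ 2 * cubeLoss lam e γ ε θ g + 2 * cubeLoss lam e γ ε θ' g := by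
  have h1 : κ * ε * hammingDist θ θ' = ∑ i, κ * (if θ i ≠ θ' i then ε else 0) := by
    rw [← Finset.mul_sum, ← Finset.sum_filter, Finset.sum_const, hammingDist, nsmul_eq_mul]
    ring
  rw [h1, cubeLoss, cubeLoss, Finset.mul_sum, Finset.mul_sum, ← Finset.sum_add_distrib]
  refine Finset.sum_le_sum fun i _ => ?_
  rw [inner_sub_right, inner_sub_right, inner_cubeSignal he, inner_cubeSignal he]
  have h0 : 0 ≤ lam (N + i) ^ (-γ) := Real.rpow_nonneg (hpos _).le _
  set x := ⟪e (N + i), g⟫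
  -- Coordinatewise this is `(a - b)² ≤ 2 (x - a)² + 2 (x - b)²` with `a, b ∈ {0, √ε}`.
  have h2 : (if θ i ≠ θ' i then ε else 0) ≤
      2 * (x - if θ i then √ε else 0) ^ 2 + 2 * (x - if θ' i then √ε else 0) ^ 2 := by
    have h3 := Real.sq_sqrt hε
    cases θ i <;> cases θ' i <;> simp <;> nlinarith [sq_nonneg x, sq_nonneg (x - √ε),
      sq_nonneg (2 * x - √ε)]
  have h4 : 0 ≤ (if θ i ≠ θ' i then ε else 0) := by split_ifs <;> simp [hε]
  calc κ * (if θ i ≠ θ' i then ε else 0)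
      ≤ lam (N + i) ^ (-γ) * (if θ i ≠ θ' i then ε else 0) :=
        mul_le_mul_of_nonneg_right (hκ i) h4
    _ ≤ lam (N + i) ^ (-γ) * _ := mul_le_mul_of_nonneg_left h2 h0
    _ = _ := by ring

/-- Some hypothesis of the hypercube is estimated badly with high probability. -/
theorem exists_cubeSignal_le_measure [IsProbabilityMeasure μ] (hpos : ∀ i, 0 < lam i) (he : Orthonormal ℝ e) {k n : ℕ}
    (hk : 0 < k) {γ ε κ τ δ : ℝ} (hε : 0 < ε) (hκ0 : 0 < κ) (hτ : 0 < τ) (hδ : 0 < δ)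
    (hκ : ∀ i : Fin (8 * k), κ ≤ lam (8 * k + i) ^ (-γ)) (hn : 32 * n * ε ≤ δ * τ ^ 2)
    (hsmall : (Real.exp 1 / 10) ^ k + Real.exp (-(k / 2 : ℝ)) ≤ δ / 2)
    {fhat : (Fin n → X × ℝ) → Lp ℝ 2 μ} (hfhat : StronglyMeasurable fhat) :
    ∃ θ : Fin (8 * k) → Bool, ENNReal.ofReal (1 - δ) ≤
      Measure.pi (fun _ : Fin n => lpModel (cubeSignal e ε θ) τ)
        {z | κ * ε * k / 4 ≤ cubeLoss lam e γ ε θ (fhat z)} := by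
  set v : ℝ≥0 := (τ ^ 2).toNNReal with hvdef
  have hv : (v : ℝ) = τ ^ 2 := Real.coe_toNNReal _ (by positivity)
  have hv0 : v ≠ 0 := by
    have : (v : ℝ) ≠ 0 := by rw [hv]; positivity
    exact_mod_cast this
  have hk' : (0 : ℝ) < k := by exact_mod_cast hk
  -- With threshold `κ * ε * k / 4`, joint acceptance of two hypotheses gives `κ * ε * hammingDist θ
  -- θ' < κ * ε * k`.
  set B : (Fin (8 * k) → Bool) → Set (Fin n → X × ℝ) := fun θ =>
    {z | cubeLoss lam e γ ε θ (fhat z) < κ * ε * k / 4} with hBdef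
  have hB : ∀ θ, MeasurableSet (B θ) := fun θ =>
    measurableSet_lt (measurable_cubeLoss γ ε θ hfhat) measurable_const
  have hPQ : ∀ θ, Measure.pi (fun _ : Fin n => lpModel (cubeSignal e ε θ) τ) (B θ) ≤
      ENNReal.ofReal (Real.exp k) *
        Measure.pi (fun _ : Fin n => gaussianModel μ 0 measurable_zero v) (B θ) +
        ENNReal.ofReal (δ / 2 + Real.exp (-(k / 2 : ℝ))) := by
    intro θ
    -- The truncation level is `t = k`: the cost `exp k` is beaten by `10 ^ (-k)`, and in the Markov
    -- term `k` cancels against the squared signal norm, at most `8 * k * ε`.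
    refine (pi_gaussianModel_le μ (cubeSignal e ε θ) _ hv0 n (hB θ) hk').trans
      (add_le_add le_rfl ?_)
    rw [ENNReal.ofReal_add (by positivity) (Real.exp_nonneg _)]
    refine add_le_add ?_ le_rfl
    rw [lintegral_ofReal_sq_div, ← ENNReal.ofReal_natCast,
      ← ENNReal.ofReal_mul (Nat.cast_nonneg n), ← ENNReal.ofReal_div_of_pos (by positivity)]
    refine ENNReal.ofReal_le_ofReal ?_
    have h1 := norm_sq_cubeSignal_le he hε.le θ
    push_cast at h1
    calc n * (‖cubeSignal e ε θ‖ ^ 2 / v) / (k / 2) ≤ n * (8 * k * ε / v) / (k / 2) := by gcongr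
      _ = 32 * n * ε / (2 * τ ^ 2) := by rw [hv]; field_simp; ring
      _ ≤ δ * τ ^ 2 / (2 * τ ^ 2) := by gcongr
      _ = δ / 2 := by field_simp
  obtain ⟨θ, hθ⟩ := exists_measure_le_of_hammingDist _ _ B hB _ _ hPQ fun z θ θ' hz hz' => by
    have h1 := mul_hammingDist_le hpos he hε.le hκ θ θ' (fhat z)
    have h2 : cubeLoss lam e γ ε θ (fhat z) < κ * ε * k / 4 := hz
    have h3 : cubeLoss lam e γ ε θ' (fhat z) < κ * ε * k / 4 := hz'
    have h4 : κ * ε * hammingDist θ θ' ≤ κ * ε * k := by linarith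
    exact_mod_cast le_of_mul_le_mul_left h4 (by positivity)
  refine ⟨θ, ?_⟩
  have hBδ : Measure.pi (fun _ : Fin n => lpModel (cubeSignal e ε θ) τ) (B θ) ≤
      ENNReal.ofReal δ := by
    refine hθ.trans ?_
    rw [← ENNReal.ofReal_mul (Real.exp_nonneg _),
      ← ENNReal.ofReal_add (by positivity) (by positivity)]
    refine ENNReal.ofReal_le_ofReal ?_
    have h5 : Real.exp k * (1 / 10) ^ k = (Real.exp 1 / 10) ^ k := by
      rw [← Real.exp_one_pow, ← mul_pow, mul_one_div]
    rw [h5]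
    linarith
  have hcompl : {z | κ * ε * k / 4 ≤ cubeLoss lam e γ ε θ (fhat z)} = (B θ)ᶜ := by
    ext z
    simp [hBdef]
  rw [hcompl, prob_compl_eq_one_sub (hB θ), ENNReal.ofReal_sub _ hδ.le, ENNReal.ofReal_one]
  exact tsub_le_tsub_left hBδ 1

end LowerBound

/-! ### Asymptotics in `k`, and eigenvalue powers on the block. -/

theorem eventually_exp_bound_le {δ : ℝ} (hδ : 0 < δ) :
    ∀ᶠ k : ℕ in Filter.atTop, (Real.exp 1 / 10) ^ k + Real.exp (-(k / 2 : ℝ)) ≤ δ / 2 := by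
  have h1 : Filter.Tendsto (fun k : ℕ => (Real.exp 1 / 10) ^ k) Filter.atTop (nhds 0) :=
    tendsto_pow_atTop_nhds_zero_of_lt_one (by positivity)
      (by linarith [Real.exp_one_lt_d9])
  have h2 : Filter.Tendsto (fun k : ℕ => Real.exp (-(k / 2 : ℝ))) Filter.atTop (nhds 0) :=
    Real.tendsto_exp_neg_atTop_nhds_zero.comp
      (tendsto_natCast_atTop_atTop.atTop_div_const (by norm_num))
  have h3 := h1.add h2
  rw [add_zero] at h3
  exact (h3.eventually_lt_const (by positivity : (0 : ℝ) < δ / 2)).mono fun k hk => hk.le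

theorem le_rpow_neg_of_eigenvalueDecay {β c₁ c₂ : ℝ} {lam : ℕ → ℝ} (hβ : 0 ≤ β) (hc₂ : 0 < c₂)
    (hpos : ∀ i, 0 < lam i) (hd : EigenvalueDecay β c₁ c₂ lam) {γ : ℝ} (hγ : 0 ≤ γ) {N : ℕ}
    (hN : 0 < N) (i : Fin N) : c₂ ^ (-γ) * (N : ℝ) ^ (β * γ) ≤ lam (N + i) ^ (-γ) := by
  have hN' : (0 : ℝ) < N := by exact_mod_cast hN
  have h1 : lam (N + i) ≤ c₂ * (N : ℝ) ^ (-β) := by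
    refine (hd (N + i)).2.trans ?_
    refine mul_le_mul_of_nonneg_left ?_ hc₂.le
    refine Real.rpow_le_rpow_of_nonpos hN' ?_ (by linarith)
    push_cast
    have : (0 : ℝ) ≤ (i : ℕ) := by positivity
    linarith
  calc c₂ ^ (-γ) * (N : ℝ) ^ (β * γ) = (c₂ * (N : ℝ) ^ (-β)) ^ (-γ) := by
        rw [Real.mul_rpow hc₂.le (by positivity), ← Real.rpow_mul hN'.le, neg_mul_neg]
    _ ≤ lam (N + i) ^ (-γ) := Real.rpow_le_rpow_of_nonpos (hpos _) h1 (by linarith)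

/-- Indices start at zero, so `lam (N + i)` is governed by `N + i + 1 ≤ 2 * N`; this produces the
factor `2 ^ (β * s)`. -/
theorem rpow_neg_le_of_eigenvalueDecay {β c₁ c₂ : ℝ} {lam : ℕ → ℝ} (hβ : 0 ≤ β) (hc₁ : 0 < c₁)
    (hd : EigenvalueDecay β c₁ c₂ lam) {s : ℝ} (hs : 0 ≤ s) {N : ℕ} (hN : 0 < N) (i : Fin N) :
    lam (N + i) ^ (-s) ≤ c₁ ^ (-s) * (2 ^ (β * s) * (N : ℝ) ^ (β * s)) := by
  have hN' : (0 : ℝ) < N := by exact_mod_cast hN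
  have h1 : c₁ * (2 * N : ℝ) ^ (-β) ≤ lam (N + i) := by
    refine le_trans ?_ (hd (N + i)).1
    refine mul_le_mul_of_nonneg_left ?_ hc₁.le
    refine Real.rpow_le_rpow_of_nonpos (by positivity) ?_ (by linarith)
    have : ((i : ℕ) : ℝ) + 1 ≤ N := by exact_mod_cast i.2
    push_cast
    linarith
  calc lam (N + i) ^ (-s) ≤ (c₁ * (2 * N : ℝ) ^ (-β)) ^ (-s) :=
        Real.rpow_le_rpow_of_nonpos (by positivity) h1 (by linarith)
    _ = _ := by
        rw [Real.mul_rpow hc₁.le (by positivity), ← Real.rpow_mul (by positivity), neg_mul_neg,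
          Real.mul_rpow (by norm_num) hN'.le]

end SpectralLower

/-! ### Choice of parameters and conclusion. -/

theorem theorem2
    (β c₁ c₂ s γ R σ L : ℝ) (hβ : 1 < β) (hc₁ : 0 < c₁) (hc₂ : 0 < c₂) (hs : 0 < s)
    (hγ : 0 ≤ γ) (hγ1 : γ ≤ 1) (hγs : γ ≤ s) (hR : 0 < R) (hσ : 0 < σ) (hL : 0 < L) :
    ∃ C : ℝ, 0 < C ∧
      ∀ (d : ℕ) (𝒳 : Set (EuclideanSpace ℝ (Fin d))) [CompactSpace 𝒳]
        (H : Type*) [NormedAddCommGroup H] [InnerProductSpace ℝ H] [CompleteSpace H]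
        [RKHS ℝ H 𝒳 ℝ] (hk : SpectralLower.ContinuousKernel H (X := 𝒳))
        (μ : Measure 𝒳) [IsProbabilityMeasure μ]
        (lam : ℕ → ℝ) (e : ℕ → Lp ℝ 2 μ),
        SpectralLower.IsEigensystem μ hk lam e →
        SpectralLower.EigenvalueDecay β c₁ c₂ lam →
        ∀ δ : ℝ, 0 < δ → δ < 1 → ∃ n₀ : ℕ, ∀ n : ℕ, n₀ ≤ n →
          ∀ fhat : (Fin n → 𝒳 × ℝ) → Lp ℝ 2 μ, StronglyMeasurable fhat →
            ∃ (ρ : Measure (𝒳 × ℝ)) (_ : IsProbabilityMeasure ρ) (fstar : Lp ℝ 2 μ),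
              SpectralLower.InModel lam e s R σ L ρ ∧
              fstar =ᵐ[μ] SpectralLower.condMean ρ ∧
              ENNReal.ofReal (1 - δ) ≤ Measure.pi (fun _ : Fin n => ρ)
                {z | ENNReal.ofReal (C * δ * (n : ℝ) ^ (-((s - γ) * β / (s * β + 1)))) ≤
                  SpectralLower.powerNorm lam e γ (fhat z - fstar) ^ 2} := by
  have hβ0 : 0 < β := by linarith
  set q : ℝ := s * β + 1 with hq
  have hq0 : 0 < q := by positivity
  set τ : ℝ := min σ L / 3 with hτdef
  have hτ : 0 < τ := by positivity
  -- The first entry keeps the hypotheses statistically close (`hnε`), the second keeps them in the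
  -- ball of radius `R` (`hsource`).
  set c₀ : ℝ := min (τ ^ 2 / 32) (R ^ 2 / (c₁ ^ (-s) * 2 ^ (β * s))) with hc₀def
  have hc₀ : 0 < c₀ := by positivity
  -- Here `32 = 4 * 8` combines the threshold's `1 / 4` with `k = N / 8`, and `16` comes from `N = 8
  -- * k ≤ 16 * n ^ (1 / q)`.
  refine ⟨c₀ * c₂ ^ (-γ) / 32 * 16 ^ (-((s - γ) * β)), by positivity, ?_⟩
  intro d 𝒳 _ H _ _ _ _ hker μ _ lam e hes hdecay δ hδ hδ1
  have hceil : Filter.Tendsto (fun n : ℕ => ⌈(n : ℝ) ^ (1 / q)⌉₊) Filter.atTop Filter.atTop :=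
    tendsto_nat_ceil_atTop.comp
      ((tendsto_rpow_atTop (by positivity)).comp tendsto_natCast_atTop_atTop)
  obtain ⟨n₀, hn₀⟩ := Filter.eventually_atTop.1
    ((hceil.eventually (SpectralLower.eventually_exp_bound_le hδ)).and
      (Filter.eventually_ge_atTop 1))
  refine ⟨n₀, fun n hn fhat hfhat => ?_⟩
  obtain ⟨hsmall, hn1⟩ := hn₀ n hn
  have hn1' : (1 : ℝ) ≤ n := by exact_mod_cast hn1
  set r : ℝ := (n : ℝ) ^ (1 / q) with hr
  have hr1 : 1 ≤ r := Real.one_le_rpow hn1' (by positivity)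
  have hrq : r ^ q = n := by
    rw [hr, ← Real.rpow_mul (by positivity), one_div_mul_cancel hq0.ne', Real.rpow_one]
  set k : ℕ := ⌈r⌉₊ with hkdef
  have hkr : r ≤ k := Nat.le_ceil r
  have hkr2 : (k : ℝ) ≤ 2 * r := by linarith [Nat.ceil_lt_add_one (zero_le_one.trans hr1)]
  have hk' : (0 : ℝ) < k := by linarith
  have hk0 : 0 < k := by exact_mod_cast hk'
  set N : ℝ := ((8 * k : ℕ) : ℝ) with hNdef
  have hN8 : N = 8 * k := by rw [hNdef]; push_cast; rfl
  have hN0 : 0 < N := by rw [hN8]; positivity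
  have hnN : (n : ℝ) ≤ N ^ q := by
    rw [← hrq]
    exact Real.rpow_le_rpow (by linarith) (by linarith) hq0.le
  set ε : ℝ := c₀ * δ * N ^ (-q) with hεdef
  have hε : 0 < ε := by positivity
  set κ : ℝ := c₂ ^ (-γ) * N ^ (β * γ) with hκdef
  have hκ0 : 0 < κ := by positivity
  have hnε : 32 * n * ε ≤ δ * τ ^ 2 := by
    have h1 : n * N ^ (-q) ≤ 1 := by
      rw [Real.rpow_neg hN0.le, ← div_eq_mul_inv]
      exact (div_le_one (by positivity)).2 hnN
    have h2 : c₀ ≤ τ ^ 2 / 32 := min_le_left _ _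
    calc 32 * n * ε = 32 * c₀ * δ * (n * N ^ (-q)) := by rw [hεdef]; ring
      _ ≤ 32 * (τ ^ 2 / 32) * δ * 1 := by gcongr
      _ = δ * τ ^ 2 := by ring
  have hsource : N * (c₁ ^ (-s) * (2 ^ (β * s) * N ^ (β * s)) * ε) ≤ R ^ 2 := by
    have h1 : N * (N ^ (β * s) * N ^ (-q)) = 1 := by
      rw [← Real.rpow_add hN0, show β * s + -q = -1 by rw [hq]; ring, Real.rpow_neg_one,
        mul_inv_cancel₀ hN0.ne']
    have h2 : c₀ * (c₁ ^ (-s) * 2 ^ (β * s)) ≤ R ^ 2 :=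
      (le_div_iff₀ (by positivity)).1 (min_le_right _ _)
    calc N * (c₁ ^ (-s) * (2 ^ (β * s) * N ^ (β * s)) * ε)
        = c₀ * (c₁ ^ (-s) * 2 ^ (β * s)) * δ * (N * (N ^ (β * s) * N ^ (-q))) := by
          rw [hεdef]; ring
      _ ≤ R ^ 2 * 1 * 1 := by rw [h1]; gcongr
      _ = R ^ 2 := by ring
  have hrate : c₀ * c₂ ^ (-γ) / 32 * 16 ^ (-((s - γ) * β)) * δ * (n : ℝ) ^ (-((s - γ) * β / q)) ≤
      κ * ε * k / 4 := by
    have h1 : (n : ℝ) ^ (-((s - γ) * β / q)) = r ^ (-((s - γ) * β)) := by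
      rw [hr, ← Real.rpow_mul (by positivity)]
      congr 1
      ring
    have h2 : (16 * r) ^ (-((s - γ) * β)) ≤ N ^ (-((s - γ) * β)) :=
      Real.rpow_le_rpow_of_nonpos hN0 (by rw [hN8]; linarith)
        (neg_nonpos.2 (mul_nonneg (by linarith) hβ0.le))
    have h3 : N ^ (β * γ) * N ^ (-q) * N = N ^ (-((s - γ) * β)) := by
      rw [← Real.rpow_add hN0, ← Real.rpow_add_one hN0.ne']
      congr 1
      rw [hq]
      ring
    calc _ = c₀ * c₂ ^ (-γ) / 32 * δ * (16 * r) ^ (-((s - γ) * β)) := by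
          rw [h1, Real.mul_rpow (by norm_num) (by positivity)]; ring
      _ ≤ c₀ * c₂ ^ (-γ) / 32 * δ * N ^ (-((s - γ) * β)) := by gcongr
      _ = κ * ε * k / 4 := by
          rw [← h3, hκdef, hεdef, show (k : ℝ) = N / 8 by rw [hN8]; ring]; ring
  obtain ⟨θ, hθ⟩ := SpectralLower.exists_cubeSignal_le_measure hes.pos hes.orthonormal hk0 hε hκ0
    hτ hδ (SpectralLower.le_rpow_neg_of_eigenvalueDecay hβ0.le hc₂ hes.pos hdecay hγ (by omega))
    hnε hsmall hfhat
  refine ⟨SpectralLower.lpModel (SpectralLower.cubeSignal e ε θ) τ, inferInstance,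
    SpectralLower.cubeSignal e ε θ, ?_, (SpectralLower.condMean_gaussianModel _ _ _).symm, ?_⟩
  · exact SpectralLower.inModel_lpModel hσ hL _ (SpectralLower.powerNorm_cubeSignal_le hes.pos hε.le
      hR.le (SpectralLower.rpow_neg_le_of_eigenvalueDecay hβ0.le hc₁ hdecay hs.le (by omega))
      hsource θ)
  · refine hθ.trans (measure_mono fun z hz => ?_)
    exact (ENNReal.ofReal_le_ofReal (hrate.trans hz)).trans
      (SpectralLower.cubeLoss_le_powerNorm_sq hes.pos hes.orthonormal γ ε θ (fhat z))
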